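/- Let $m\ge 1$, let $f_1,\dots,f_m:\mathbb{R}^p\to\mathbb{R}$ be $G$-Lipschitz and $L$-smooth (differentiable with $L$-Lipschitz gradient), $G,L>0$, and let $f(x)=\max_{1\le i\le m} f_i(x)\ge f^*>-\infty$ for all $x$. Let $0<\varepsilon\le\varepsilon_0$, $x_0\in\mathbb{R}^p$. **Definitions.** A point $x$ is an $\varepsilon$-FOSP of an $L$-weakly convex function $f$ if $\|\nabla f_{1/(2L)}(x)\|\le\varepsilon$, where $f_{1/(2L)}(x)=\min_{x'} f(x')+L\|x-x'\|^2$ is the Moreau envelope. Put $\hat f(x;c)=\max_i \big(f_i(c)+\langle\nabla f_i(c),x-c\rangle\big)+\frac L2\|x-c\|^2$. *Prox-FDIAG* with accuracy $\varepsilon'$ started at $x_0$: let $\tilde\varepsilon=\varepsilon'^2/(64L)$; for $k=0,1,\dots$ apply the inner solver to $\min_x\hat f(x;x_k)$ until its primal-dual gap is at most $\tilde\varepsilon/4$, and let $x_{k+1}$ be its primal output, so that $\hat f(x_{k+1};x_k)\le\min_x\hat f(x;x_k)+\tilde\varepsilon/4$; if $f(x_k)-\frac34\tilde\varepsilon<\hat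 f(x_{k+1};x_k)$, return $x_k$. The inner solver is Nesterov's excessive gap technique for strongly convex functions, applied to $\min_x\max_{u\in\Delta_m}\sum_i u_i\big(f_i(x_k)+\langle\nabla f_i(x_k),x-x_k\rangle\big)+\frac L2\|x-x_k\|^2$ with the entropy as prox-function of the simplex $\Delta_m$ and with smoothing parameter $\frac{4G^2}{L(j+1)(j+2)}$ after $j$ iterations. *Adaptive Prox-FDIAG* starts with $\varepsilon'=\varepsilon_0$ and the point $x_0$ and repeats: run Prox-FDIAG with accuracy $\varepsilon'$ from the current point and move to its output; if $\varepsilon'=\varepsilon$, return this point, otherwise replace $\varepsilon'$ by $\max(\varepsilon'/2,\varepsilon)$. **Claim.** Let $K=\lceil\log_2(\varepsilon_0/\varepsilon)\rceil$ and $C=\frac{4^4L(f(x_0)-f^*)}{3\varepsilon^2}$; $\log$ is the natural logarithm. Then Adaptive Prox-FDIAG halts after exactly $K$ changes of the target accuracy, that is, after exactly $K+1$ runs of Prox-FDIAG; $f$ is $L$-weakly convex and the output is an $\varepsilon$-FOSP of $f$. Moreover: 1. The total work of the inner solver, with each of its iterations charged $m\log m$, is at most $(K+1)\,(\lfloor C\rfloor+1)\,\Big\lceil\frac{2^5G}{\varepsilon}\,m\log^{3/2}m\Big\rceil$.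 2. The total number of calls of the first-order oracle of the components (a call returns $f_i(x)$ and $\nabla f_i(x)$ for one $i$ and one $x$; each inner problem needs $m$ calls) is at most $(K+1)(\lfloor C\rfloor+1)\,m$. If $\varepsilon<\varepsilon_0$, $f^*<f(x_0)$, $m\ge2$ and $\varepsilon\le G$, it is also at most $K\,\lceil C\rceil\,\Big\lceil\frac{2^4G}{\varepsilon}\,m\log^{3/2}m\Big\rceil$. -/

import Mathlib

open scoped Gradient

noncomputable section

namespace ProxFDIAG

/-- The space `ℝ^p` with the Euclidean norm. -/
abbrev E (p : ℕ) := EuclideanSpace ℝ (Fin p)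

/-! ### Smoothness, weak convexity, Moreau envelope, approximate stationarity -/

/-- `g` is differentiable and its gradient is `L`-Lipschitz. -/
def LSmooth {p : ℕ} (L : ℝ) (g : E p → ℝ) : Prop :=
  Differentiable ℝ g ∧ ∀ x y, ‖∇ g x - ∇ g y‖ ≤ L * ‖x - y‖

/-- `g` is `G`-Lipschitz. -/
def GLipschitz {p : ℕ} (G : ℝ) (g : E p → ℝ) : Prop :=
  ∀ x y, |g x - g y| ≤ G * ‖x - y‖

/-- The Fréchet subdifferential of `g` at `x`; the lower limit is taken in the extended reals
and over the punctured neighbourhoods of `x`. -/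
def frechetSubdiff {p : ℕ} (g : E p → ℝ) (x : E p) : Set (E p) :=
  {u | (0 : EReal) ≤ Filter.liminf
    (fun x' : E p => (((g x' - g x - inner ℝ u (x' - x)) / ‖x' - x‖ : ℝ) : EReal))
    (nhdsWithin x {x}ᶜ)}

/-- `L`-weak convexity: every Fréchet subgradient gives a global quadratic lower bound. -/
def WeaklyConvex {p : ℕ} (L : ℝ) (g : E p → ℝ) : Prop :=
  ∀ x, ∀ u ∈ frechetSubdiff g x, ∀ x',
    g x + inner ℝ u (x' - x) - L / 2 * ‖x' - x‖ ^ 2 ≤ g x'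

/-- The Moreau envelope of `g` with parameter `lam`. -/
def moreauEnv {p : ℕ} (g : E p → ℝ) (lam : ℝ) (x : E p) : ℝ :=
  ⨅ x' : E p, (g x' + 1 / (2 * lam) * ‖x - x'‖ ^ 2)

/-- `x` is an `ε`-first-order stationary point of the `L`-weakly convex function `g`: the Moreau
envelope with parameter `1 / (2L)` is differentiable at `x` with a gradient of norm at most `ε`. -/
def IsFOSP {p : ℕ} (L : ℝ) (g : E p → ℝ) (ε : ℝ) (x : E p) : Prop :=
  WeaklyConvex L g ∧
    ∃ v : E p, HasGradientAt (moreauEnv g (1 / (2 * L))) v x ∧ ‖v‖ ≤ ε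

/-! ### The finite max-type function and its quadratic model -/

/-- `f(x) = max_i f_i(x)`. -/
def maxFun {p m : ℕ} (f : Fin m → E p → ℝ) (x : E p) : ℝ := ⨆ i, f i x

/-- The linearization of the `i`-th component at `c`, evaluated at `x`. -/
def lin {p m : ℕ} (f : Fin m → E p → ℝ) (c x : E p) (i : Fin m) : ℝ :=
  f i c + inner ℝ (∇ (f i) c) (x - c)

/-- The quadratic model `f̂(x; c)` of `max_i f_i` at the prox centre `c`. -/
def model {p m : ℕ} (f : Fin m → E p → ℝ) (L : ℝ) (c x : E p) : ℝ :=
  ⨆ i, (lin f c x i + L / 2 * ‖x - c‖ ^ 2)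

/-! ### The inner solver

The excessive gap technique for the strongly convex problem `min_x f̂(x; c)`, written as the
saddle point problem `min_x max_{u ∈ Δ_m} ∑ i, u i * lin f c x i + L / 2 * ‖x - c‖ ^ 2` over the
probability simplex `Δ_m`, with the entropy `log m + ∑ i, u i * log (u i)` as prox-function of
the simplex. -/

/-- The saddle function. -/
def saddle {p m : ℕ} (f : Fin m → E p → ℝ) (L : ℝ) (c x : E p) (u : Fin m → ℝ) : ℝ :=
  (∑ i, u i * lin f c x i) + L / 2 * ‖x - c‖ ^ 2

/-- The dual function. -/
def dualFun {p m : ℕ} (f : Fin m → E p → ℝ) (L : ℝ) (c : E p) (u : Fin m → ℝ) : ℝ :=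
  ⨅ x : E p, saddle f L c x u

/-- The minimizer of the saddle function in `x`, for fixed `u`. The dual function has the
gradient `lin f c (primalPt f L c u)` at `u`. -/
def primalPt {p m : ℕ} (f : Fin m → E p → ℝ) (L : ℝ) (c : E p) (u : Fin m → ℝ) : E p :=
  c - (1 / L) • ∑ i, u i • ∇ (f i) c

/-- The Bregman projection for the entropy: the maximizer over the simplex of
`∑ i, s i * (u i - z i)` minus the relative entropy of `u` with respect to `z`. -/
def bregman {m : ℕ} (z s : Fin m → ℝ) (i : Fin m) : ℝ :=
  z i * Real.exp (s i) / ∑ j, z j * Real.exp (s j)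

/-- The centre of the simplex, the minimizer of the prox-function. -/
def simplexCentre (m : ℕ) : Fin m → ℝ := fun _ => 1 / (m : ℝ)

/-- The maximizer over the simplex of the saddle function minus `mu` times the prox-function. -/
def dualPt {p m : ℕ} (f : Fin m → E p → ℝ) (c : E p) (mu : ℝ) (x : E p) : Fin m → ℝ :=
  bregman (simplexCentre m) (fun i => lin f c x i / mu)

/-- The smoothing parameter at iteration `k`; it satisfies `mu (k+1) = (1 - τ k) * mu k` with
`τ k = 2 / (k + 3)`, and it starts from twice the Lipschitz constant `G ^ 2 / L` of the gradient
of the dual function. -/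
def smoothing (L G : ℝ) (k : ℕ) : ℝ :=
  4 * (G ^ 2 / L) / (((k : ℝ) + 1) * ((k : ℝ) + 2))

/-- One iteration, from the iterates `(x, u)` with smoothing parameter `mu` and step `τ`. -/
def egStep {p m : ℕ} (f : Fin m → E p → ℝ) (L : ℝ) (c : E p) (mu τ : ℝ)
    (s : E p × (Fin m → ℝ)) : E p × (Fin m → ℝ) :=
  let z : Fin m → ℝ := dualPt f c mu s.1
  let w : Fin m → ℝ := (1 - τ) • s.2 + τ • z
  let x' : E p := primalPt f L c w
  let v : Fin m → ℝ := bregman z (fun i => τ / ((1 - τ) * mu) * lin f c x' i)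
  ((1 - τ) • s.1 + τ • x', (1 - τ) • s.2 + τ • v)

/-- The primal and dual iterates of the excessive gap technique. -/
def egIter {p m : ℕ} (f : Fin m → E p → ℝ) (L G : ℝ) (c : E p) : ℕ → E p × (Fin m → ℝ)
  | 0 =>
    let x := primalPt f L c (simplexCentre m)
    (x, dualPt f c (smoothing L G 0) x)
  | k + 1 => egStep f L c (smoothing L G k) (2 / ((k : ℝ) + 3)) (egIter f L G c k)

/-- The primal-dual gap after `k` iterations. -/
def egGap {p m : ℕ} (f : Fin m → E p → ℝ) (L G : ℝ) (c : E p) (k : ℕ) : ℝ :=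
  model f L c (egIter f L G c k).1 - dualFun f L c (egIter f L G c k).2

/-- With the stopping rule "primal-dual gap at most `δ`", the inner solver stops after exactly
`N` iterations and returns `x`. (The dual iterate lies in the simplex, so this ensures
`f̂(x; c) ≤ min f̂(·; c) + δ`.) -/
def InnerSolve {p m : ℕ} (f : Fin m → E p → ℝ) (L G δ : ℝ) (c : E p) (N : ℕ) (x : E p) : Prop :=
  egGap f L G c N ≤ δ ∧ (∀ n < N, δ < egGap f L G c n) ∧ x = (egIter f L G c N).1

/-! ### The two algorithms

The relations below say that the algorithm halts, with which output and at which cost.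
Each inner problem uses the values and the gradients of the `m` components at the current point,
which are `m` calls of the first-order oracle of the components. -/

/-- The accuracy parameter `ε² / (64 L)`. -/
def innerTol (L ε : ℝ) : ℝ := ε ^ 2 / (64 * L)

/-- `ProxRun f L G ε x out calls iters`: Prox-FDIAG with target accuracy `ε`, at the point `x`,
halts with the output `out`, after `calls` calls of the first-order oracle of the components and
`iters` iterations of the inner solver in total. -/
inductive ProxRun {p m : ℕ} (f : Fin m → E p → ℝ) (L G ε : ℝ) : E p → E p → ℕ → ℕ → Prop
  | halt (x x' : E p) (N : ℕ) (hin : InnerSolve f L G (innerTol L ε / 4) x N x')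
      (htest : maxFun f x - 3 * innerTol L ε / 4 < model f L x x') :
      ProxRun f L G ε x x m N
  | descend (x x' out : E p) (N calls iters : ℕ)
      (hin : InnerSolve f L G (innerTol L ε / 4) x N x')
      (htest : ¬ maxFun f x - 3 * innerTol L ε / 4 < model f L x x')
      (hrest : ProxRun f L G ε x' out calls iters) :
      ProxRun f L G ε x out (m + calls) (N + iters)

/-- `AdaptiveLoop f L G ε ε' x out runs calls iters`: the loop of Adaptive Prox-FDIAG with target
accuracy `ε`, entered at the point `x` with current accuracy `ε'`, halts with the output `out`
after `runs` runs of Prox-FDIAG, with the total cost `calls` and `iters`. -/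
inductive AdaptiveLoop {p m : ℕ} (f : Fin m → E p → ℝ) (L G ε : ℝ) :
    ℝ → E p → E p → ℕ → ℕ → ℕ → Prop
  | last (ε' : ℝ) (x out : E p) (calls iters : ℕ)
      (hrun : ProxRun f L G ε' x out calls iters) (heq : ε = ε') :
      AdaptiveLoop f L G ε ε' x out 1 calls iters
  | next (ε' : ℝ) (x x' out : E p) (runs calls iters calls' iters' : ℕ)
      (hrun : ProxRun f L G ε' x x' calls iters) (hne : ε ≠ ε')
      (hrest : AdaptiveLoop f L G ε (max (ε' / 2) ε) x' out runs calls' iters') :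
      AdaptiveLoop f L G ε ε' x out (1 + runs) (calls + calls') (iters + iters')

/-- Adaptive Prox-FDIAG with initial accuracy `ε₀` and target accuracy `ε`, started at `x₀`. -/
def AdaptiveProxFDIAG {p m : ℕ} (f : Fin m → E p → ℝ) (L G ε ε₀ : ℝ) (x₀ out : E p)
    (runs calls iters : ℕ) : Prop :=
  AdaptiveLoop f L G ε (max ε₀ ε) x₀ out runs calls iters

end ProxFDIAG

end

/-! The model `f̂(·; c)` lies above `f` and exceeds it by at most `L * ‖· - c‖ ^ 2`
(`maxFun_le_model`, `model_le_maxFun_add`). Hence a failed stopping test lowers `f` by at least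
`3/4` of the tolerance. A passed test says that the model cannot improve on `f x` by more than the
tolerance, so the proximal point of `x` is close to `x`, and the gradient of the Moreau envelope, `2
* L` times their difference, is small (`isFOSP_of_test`).

Inside, the excessive gap condition bounds the primal-dual gap by `mu * log m` and survives each
step because Pinsker's inequality makes the relative entropy dominate the squared `ℓ¹` norm, in
which the dual function is `G ^ 2 / L`-smooth (`ExcessiveGap.step`). As `mu` decays quadratically,
each inner problem takes at most `2 ^ 5 * G / ε * √(log m)` iterations.

The decrease of `f` telescopes across the runs, and each descent step gains at least `3/4 * innerTol
L ε`, also at the coarser accuracies. So there are at most `⌊C⌋` descent steps in all, plus one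
halting inner problem in each of the `K + 1` runs. The stated products follow from this additive
count. -/

noncomputable section

namespace ProxFDIAG

section

variable {p m : ℕ}

/-! ### Smooth functions -/

/-- The two-sided quadratic bound for a function with Lipschitz gradient. -/
lemma LSmooth.abs_sub_le {L : ℝ} {g : E p → ℝ} (hg : LSmooth L g) (x y : E p) :
    |g y - g x - inner ℝ (∇ g x) (y - x)| ≤ L / 2 * ‖y - x‖ ^ 2 := by
  obtain ⟨hd, hl⟩ := hg
  set d := y - x with hdd
  have hline : ∀ t : ℝ, HasDerivAt (fun t : ℝ => x + t • d) d t := fun t => by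
    simpa using ((hasDerivAt_id t).smul_const d).const_add x
  have hderiv : ∀ t : ℝ, HasDerivAt (fun t : ℝ => g (x + t • d) - g x - t * inner ℝ (∇ g x) d)
      (inner ℝ (∇ g (x + t • d) - ∇ g x) d) t := fun t => by
    have h1 := (hd (x + t • d)).hasGradientAt.hasFDerivAt.comp_hasDerivAt t (hline t)
    have h2 := (h1.sub_const (g x)).sub ((hasDerivAt_id t).mul_const (inner ℝ (∇ g x) d))
    refine h2.congr_deriv ?_
    simp [inner_sub_left]
  have hB : ∀ t : ℝ, HasDerivAt (fun t : ℝ => L / 2 * ‖d‖ ^ 2 * t ^ 2)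
      (L * ‖d‖ ^ 2 * t) t := fun t => by
    have := ((hasDerivAt_pow 2 t).const_mul (L / 2 * ‖d‖ ^ 2))
    exact this.congr_deriv (by push_cast; ring)
  -- The first-order remainder along the segment grows no faster than `L / 2 * ‖d‖ ^ 2 * t ^ 2`, and
  -- both vanish at `t = 0`.
  have key := image_norm_le_of_norm_deriv_right_le_deriv_boundary (a := (0 : ℝ)) (b := 1)
    (f := fun t : ℝ => g (x + t • d) - g x - t * inner ℝ (∇ g x) d)
    (fun t _ => (hderiv t).continuousAt.continuousWithinAt)
    (fun t _ => (hderiv t).hasDerivWithinAt) (by simp) hB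
    (fun t ht => by
      have hlt : ‖∇ g (x + t • d) - ∇ g x‖ ≤ L * (t * ‖d‖) := by
        have := hl (x + t • d) x
        rwa [add_sub_cancel_left, norm_smul, Real.norm_of_nonneg ht.1] at this
      calc ‖inner ℝ (∇ g (x + t • d) - ∇ g x) d‖
          ≤ ‖∇ g (x + t • d) - ∇ g x‖ * ‖d‖ := norm_inner_le_norm _ _
        _ ≤ L * (t * ‖d‖) * ‖d‖ := by gcongr
        _ = L * ‖d‖ ^ 2 * t := by ring) (x := 1) (by simp)
  simpa [hdd] using key

/-- The gradient of a `G`-Lipschitz function has norm at most `G`. -/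
lemma GLipschitz.norm_gradient_le {G : ℝ} (hG : 0 ≤ G) {g : E p → ℝ} (hg : GLipschitz G g)
    (x : E p) : ‖∇ g x‖ ≤ G := by
  have h : ‖fderiv ℝ g x‖ ≤ G :=
    norm_fderiv_le_of_lip' ℝ hG (Filter.Eventually.of_forall fun y => hg y x)
  simpa [gradient] using h

/-- Along a segment, a function with `L`-Lipschitz gradient exceeds the chord by at most the
deviation of `L / 2 * ‖·‖ ^ 2`. -/
lemma LSmooth.segment_le {L : ℝ} {g : E p → ℝ} (hg : LSmooth L g) (x y : E p) {t : ℝ}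
    (h0 : 0 ≤ t) (h1 : t ≤ 1) :
    g (x + t • (y - x)) ≤ (1 - t) * g x + t * g y + L / 2 * (t * (1 - t)) * ‖y - x‖ ^ 2 := by
  set c := x + t • (y - x) with hc
  have e1 : x - c = (-t) • (y - x) := by rw [hc]; module
  have e2 : y - c = (1 - t) • (y - x) := by rw [hc]; module
  -- Both lower bounds are based at the intermediate point `c`: with weights `1 - t` and `t` the
  -- gradient terms cancel, and the quadratic terms add up to `t * (1 - t)`.
  have b1 := (abs_le.1 (hg.abs_sub_le c x)).1
  have b2 := (abs_le.1 (hg.abs_sub_le c y)).1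
  rw [e1, inner_smul_right, norm_smul, mul_pow, Real.norm_eq_abs, sq_abs] at b1
  rw [e2, inner_smul_right, norm_smul, mul_pow, Real.norm_eq_abs, sq_abs] at b2
  have h1' : 0 ≤ 1 - t := by linarith
  linear_combination (1 - t) * b1 + t * b2

/-! ### Finite maxima of smooth functions -/

lemma le_maxFun (f : Fin m → E p → ℝ) (x : E p) (i : Fin m) : f i x ≤ maxFun f x :=
  le_ciSup (f := fun i => f i x) (Set.finite_range _).bddAbove i

/-- The error term does not depend on `i`, so the inequality passes to the maximum. It is the form
of weak convexity that both the subgradient bound and the proximal growth bound use. -/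
lemma maxFun_segment_le [Nonempty (Fin m)] {L : ℝ} {f : Fin m → E p → ℝ}
    (hf : ∀ i, LSmooth L (f i)) (x y : E p) {t : ℝ} (h0 : 0 ≤ t) (h1 : t ≤ 1) :
    maxFun f (x + t • (y - x)) ≤
      (1 - t) * maxFun f x + t * maxFun f y + L / 2 * (t * (1 - t)) * ‖y - x‖ ^ 2 := by
  refine ciSup_le fun i => ((hf i).segment_le x y h0 h1).trans ?_
  have h1' : 0 ≤ 1 - t := by linarith
  gcongr <;> apply le_maxFun

lemma maxFun_continuous [Nonempty (Fin m)] {L : ℝ} {f : Fin m → E p → ℝ}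
    (hf : ∀ i, LSmooth L (f i)) : Continuous (maxFun f) := by
  have h : maxFun f = fun x => Finset.univ.sup' Finset.univ_nonempty (fun i => f i x) := by
    ext x
    exact (Finset.sup'_univ_eq_ciSup _).symm
  rw [h]
  exact Continuous.finset_sup'_apply _ fun i _ => (hf i).1.continuous

/-! ### Weak convexity -/

/-- A Fréchet subgradient bounds the one-sided difference quotients from below. -/
lemma eventually_of_mem_frechetSubdiff {g : E p → ℝ} {x u : E p} (hu : u ∈ frechetSubdiff g x)
    {d : E p} (hd : d ≠ 0) {η : ℝ} (hη : 0 < η) :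
    ∀ᶠ t : ℝ in nhdsWithin 0 (Set.Ioi 0),
      t * inner ℝ u d - η * (t * ‖d‖) ≤ g (x + t • d) - g x := by
  have h1 : ((-η : ℝ) : EReal) < Filter.liminf
      (fun x' : E p => (((g x' - g x - inner ℝ u (x' - x)) / ‖x' - x‖ : ℝ) : EReal))
      (nhdsWithin x {x}ᶜ) := lt_of_lt_of_le (by exact_mod_cast neg_lt_zero.2 hη) hu
  have h2 := Filter.eventually_lt_of_lt_liminf h1
  have h3 : Filter.Tendsto (fun t : ℝ => x + t • d) (nhdsWithin 0 (Set.Ioi 0))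
      (nhdsWithin x {x}ᶜ) := by
    refine tendsto_nhdsWithin_iff.2 ⟨?_, ?_⟩
    · have : Continuous fun t : ℝ => x + t • d := by fun_prop
      simpa using (this.tendsto 0).mono_left nhdsWithin_le_nhds
    · filter_upwards [self_mem_nhdsWithin] with t ht
      simp [hd, (Set.mem_Ioi.1 ht).ne']
  filter_upwards [h3.eventually h2, self_mem_nhdsWithin] with t ht ht0
  have ht0' : 0 < t := ht0
  have hpos : 0 < t * ‖d‖ := mul_pos ht0' (norm_pos_iff.2 hd)
  rw [EReal.coe_lt_coe_iff, add_sub_cancel_left, norm_smul, Real.norm_of_nonneg ht0'.le,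
    inner_smul_right, lt_div_iff₀ hpos] at ht
  linarith

/-- Near `x`, the subgradient bounds `f` from below along the segment to `y`, while
`maxFun_segment_le` bounds it from above. Dividing by `t`, then letting `t → 0` and `η → 0`, leaves
the global bound. -/
lemma maxFun_weaklyConvex [Nonempty (Fin m)] {L : ℝ} {f : Fin m → E p → ℝ}
    (hf : ∀ i, LSmooth L (f i)) : WeaklyConvex L (maxFun f) := by
  intro x u hu y
  obtain hd | hd := eq_or_ne (y - x) 0
  · rw [sub_eq_zero.1 hd]; simp
  set d := y - x with hdd
  set S := maxFun f y - maxFun f x + L / 2 * ‖d‖ ^ 2 - inner ℝ u d with hS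
  have key : ∀ η > 0, ∀ᶠ t : ℝ in nhdsWithin 0 (Set.Ioi 0),
      L / 2 * ‖d‖ ^ 2 * t ≤ S + η * ‖d‖ := fun η hη => by
    filter_upwards [eventually_of_mem_frechetSubdiff hu hd hη,
      Ioo_mem_nhdsGT (zero_lt_one' ℝ)] with t ht ht01
    have h := maxFun_segment_le hf x y ht01.1.le ht01.2.le
    rw [← hdd] at h
    refine le_of_mul_le_mul_left ?_ ht01.1
    rw [hS]
    linear_combination ht + h
  have key2 : ∀ η > 0, 0 ≤ S + η * ‖d‖ := fun η hη => by
    have hlim : Filter.Tendsto (fun t : ℝ => L / 2 * ‖d‖ ^ 2 * t) (nhdsWithin 0 (Set.Ioi 0))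
        (nhds 0) := by
      have : Continuous fun t : ℝ => L / 2 * ‖d‖ ^ 2 * t := by fun_prop
      simpa using (this.tendsto 0).mono_left nhdsWithin_le_nhds
    exact le_of_tendsto hlim (key η hη)
  have hfin : 0 ≤ S := by
    refine le_of_forall_pos_le_add fun η hη => ?_
    have := key2 (η / ‖d‖) (div_pos hη (norm_pos_iff.2 hd))
    rwa [div_mul_cancel₀ _ (norm_ne_zero_iff.2 hd)] at this
  rw [hS] at hfin
  linarith

/-! ### The Moreau envelope -/

lemma moreauEnv_half {L : ℝ} (hL : 0 < L) (g : E p → ℝ) (x : E p) :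
    moreauEnv g (1 / (2 * L)) x = ⨅ y : E p, (g y + L * ‖x - y‖ ^ 2) := by
  have : 1 / (2 * (1 / (2 * L))) = L := by field_simp
  rw [moreauEnv, this]

/-- The proximal subproblem has a solution. -/
lemma exists_prox {L fstar : ℝ} (hL : 0 < L) {g : E p → ℝ} (hg : Continuous g)
    (hbdd : ∀ x, fstar ≤ g x) (x : E p) :
    ∃ y, ∀ z, g y + L * ‖x - y‖ ^ 2 ≤ g z + L * ‖x - z‖ ^ 2 := by
  refine Continuous.exists_forall_le (f := fun z => g z + L * ‖x - z‖ ^ 2) (by fun_prop) ?_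
  have h1 : Filter.Tendsto (fun z : E p => ‖x - z‖) (Filter.cocompact _) Filter.atTop := by
    simp only [← dist_eq_norm]
    exact tendsto_dist_left_cocompact_atTop x
  have h2 : Filter.Tendsto (fun z : E p => fstar + L * ‖x - z‖ ^ 2) (Filter.cocompact _)
      Filter.atTop :=
    Filter.tendsto_atTop_add_const_left _ _
      (((Filter.tendsto_pow_atTop two_ne_zero).comp h1).const_mul_atTop hL)
  exact Filter.tendsto_atTop_mono (fun z => by gcongr; exact hbdd z) h2

/-- Quadratic growth of the proximal objective around its minimizer. -/
lemma prox_growth {L : ℝ} {g : E p → ℝ}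
    (hseg : ∀ x y, ∀ t : ℝ, 0 ≤ t → t ≤ 1 →
      g (x + t • (y - x)) ≤ (1 - t) * g x + t * g y + L / 2 * (t * (1 - t)) * ‖y - x‖ ^ 2)
    {x y : E p} (hy : ∀ z, g y + L * ‖x - y‖ ^ 2 ≤ g z + L * ‖x - z‖ ^ 2) (z : E p) :
    g y + L * ‖x - y‖ ^ 2 + L / 2 * ‖z - y‖ ^ 2 ≤ g z + L * ‖x - z‖ ^ 2 := by
  set S := g z + L * ‖x - z‖ ^ 2 - (g y + L * ‖x - y‖ ^ 2 + L / 2 * ‖z - y‖ ^ 2) with hS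
  -- The proximal term has modulus `2 * L` and `g` loses at most `L`, so the objective is
  -- `L`-strongly convex. Minimality of `y` is tested on the segment to `z`, divided by `t`, and `t`
  -- tends to `0`.
  have key : ∀ᶠ t : ℝ in nhdsWithin 0 (Set.Ioi 0), -(L / 2 * ‖z - y‖ ^ 2) * t ≤ S := by
    filter_upwards [Ioo_mem_nhdsGT (zero_lt_one' ℝ)] with t ht
    have h1 := hy (y + t • (z - y))
    have h2 := hseg y z t ht.1.le ht.2.le
    have e1 : ‖x - (y + t • (z - y))‖ ^ 2 =
        ‖x - y‖ ^ 2 - 2 * t * inner ℝ (x - y) (z - y) + t ^ 2 * ‖z - y‖ ^ 2 := by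
      rw [← sub_sub, norm_sub_sq_real, inner_smul_right, norm_smul, mul_pow, Real.norm_eq_abs,
        sq_abs]
      ring
    have e2 : ‖x - z‖ ^ 2 =
        ‖x - y‖ ^ 2 - 2 * inner ℝ (x - y) (z - y) + ‖z - y‖ ^ 2 := by
      rw [← norm_sub_sq_real]; congr 2; abel
    rw [e1] at h1
    refine le_of_mul_le_mul_left ?_ ht.1
    rw [hS, e2]
    linear_combination h1 + h2
  have hlim : Filter.Tendsto (fun t : ℝ => -(L / 2 * ‖z - y‖ ^ 2) * t)
      (nhdsWithin 0 (Set.Ioi 0)) (nhds 0) := by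
    have : Continuous fun t : ℝ => -(L / 2 * ‖z - y‖ ^ 2) * t := by fun_prop
    simpa using (this.tendsto 0).mono_left nhdsWithin_le_nhds
  have := le_of_tendsto hlim key
  linarith

/-- The gradient of the Moreau envelope, in terms of the proximal point. -/
lemma hasGradientAt_moreauEnv {L : ℝ} (hL : 0 < L) {g : E p → ℝ} {x y : E p}
    (hy : ∀ z, g y + L * ‖x - y‖ ^ 2 + L / 2 * ‖z - y‖ ^ 2 ≤ g z + L * ‖x - z‖ ^ 2) :
    HasGradientAt (moreauEnv g (1 / (2 * L))) ((2 * L) • (x - y)) x := by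
  set F := moreauEnv g (1 / (2 * L)) with hF
  have expand : ∀ z w : E p, ‖z - w‖ ^ 2 =
      ‖x - w‖ ^ 2 + 2 * inner ℝ (x - w) (z - x) + ‖z - x‖ ^ 2 := fun z w => by
    rw [← norm_add_sq_real]; congr 2; abel
  -- The growth term `L / 2 * ‖w - y‖ ^ 2` absorbs the cross term in `w - y` by completing the
  -- square. The choice `w = y` gives the matching upper bound, so the first-order remainder of the
  -- envelope is at most `L * ‖z - x‖ ^ 2`.
  have lower : ∀ z w : E p, g y + L * ‖x - y‖ ^ 2 + 2 * L * inner ℝ (x - y) (z - x)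
      - L * ‖z - x‖ ^ 2 ≤ g w + L * ‖z - w‖ ^ 2 := fun z w => by
    have h1 := hy w
    have h2 : 0 ≤ ‖(w - y) - (2 : ℝ) • (z - x)‖ ^ 2 := by positivity
    rw [norm_sub_sq_real, inner_smul_right, norm_smul, mul_pow] at h2
    have h3 : inner ℝ (x - w) (z - x) = inner ℝ (x - y) (z - x) - inner ℝ (w - y) (z - x) := by
      rw [← inner_sub_left]; congr 1; abel
    rw [expand z w, h3]
    norm_num at h2
    nlinarith
  have hle : ∀ z w, F z ≤ g w + L * ‖z - w‖ ^ 2 := fun z w => by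
    rw [hF, moreauEnv_half hL]
    exact ciInf_le ⟨_, Set.forall_mem_range.2 (lower z)⟩ w
  have hge : ∀ z, g y + L * ‖x - y‖ ^ 2 + 2 * L * inner ℝ (x - y) (z - x)
      - L * ‖z - x‖ ^ 2 ≤ F z := fun z => by
    rw [hF, moreauEnv_half hL]
    exact le_ciInf (lower z)
  have hx : F x = g y + L * ‖x - y‖ ^ 2 :=
    le_antisymm (hle x y) (by simpa using hge x)
  rw [hasGradientAt_iff_isLittleO]
  have hO : (fun z => F z - F x - inner ℝ ((2 * L) • (x - y)) (z - x)) =O[nhds x]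
      fun z => ‖z - x‖ ^ 2 := by
    refine Asymptotics.IsBigO.of_bound L (Filter.Eventually.of_forall fun z => ?_)
    rw [inner_smul_left, hx, Real.norm_eq_abs, norm_pow, norm_norm, abs_le]
    have h1 := hge z
    have h2 := hle z y
    rw [expand z y] at h2
    simp only [conj_trivial]
    constructor <;> linarith
  refine hO.trans_isLittleO ?_
  have h0 : Filter.Tendsto (fun z : E p => z - x) (nhds x) (nhds 0) := by
    have : Continuous fun z : E p => z - x := by fun_prop
    simpa using this.tendsto x
  exact (Asymptotics.isLittleO_norm_pow_id one_lt_two).comp_tendsto h0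

end

section

variable {p m : ℕ}

/-! ### Relative entropy on the simplex -/

/-- The relative entropy of `y` with respect to `z`. -/
def relEntropy (y z : Fin m → ℝ) : ℝ := ∑ i, y i * (Real.log (y i) - Real.log (z i))

/-- The difference of the two sides has derivative `(t - 1) ^ 3 / (t ^ 2 * (t + 2) ^ 2)`, so its
minimum is at `t = 1`, where it vanishes. -/
lemma log_ge_pade {t : ℝ} (ht : 0 < t) :
    (t - 1) * (5 * t + 1) / (2 * t * (t + 2)) ≤ Real.log t := by
  set F : ℝ → ℝ := fun t => Real.log t - (t - 1) * (5 * t + 1) / (2 * t * (t + 2)) with hF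
  have hder : ∀ s : ℝ, 0 < s → HasDerivAt F ((s - 1) ^ 3 / (s ^ 2 * (s + 2) ^ 2)) s := by
    intro s hs
    have hne : 2 * s * (s + 2) ≠ 0 := by positivity
    have h1 : HasDerivAt (fun t : ℝ => (t - 1) * (5 * t + 1))
        (1 * (5 * s + 1) + (s - 1) * (5 * 1)) s :=
      ((hasDerivAt_id s).sub_const 1).mul (((hasDerivAt_id s).const_mul 5).add_const 1)
    have h2 : HasDerivAt (fun t : ℝ => 2 * t * (t + 2))
        (2 * 1 * (s + 2) + 2 * s * 1) s :=
      ((hasDerivAt_id s).const_mul 2).mul ((hasDerivAt_id s).add_const 2)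
    refine ((Real.hasDerivAt_log hs.ne').sub (h1.div h2 hne)).congr_deriv ?_
    have : s + 2 ≠ 0 := by positivity
    field_simp
    ring
  have hcont : ∀ s : Set ℝ, s ⊆ Set.Ioi 0 → ContinuousOn F s := fun s hs t ht =>
    (hder t (hs ht)).continuousAt.continuousWithinAt
  have hF1 : F 1 = 0 := by simp [hF]
  suffices 0 ≤ F t by simpa [hF] using this
  rw [← hF1]
  obtain h | h := le_total t 1
  · refine antitoneOn_of_deriv_nonpos (convex_Ioc 0 1) (hcont _ fun s hs => hs.1)
      (fun s hs => ?_) (fun s hs => ?_) ⟨ht, h⟩ ⟨one_pos, le_rfl⟩ h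
    · rw [interior_Ioc] at hs
      exact (hder s hs.1).differentiableAt.differentiableWithinAt
    · rw [interior_Ioc] at hs
      rw [(hder s hs.1).deriv]
      refine div_nonpos_of_nonpos_of_nonneg ?_ (by positivity)
      exact (Odd.pow_nonpos_iff (by decide)).2 (by linarith [hs.2])
  · refine monotoneOn_of_deriv_nonneg (convex_Ici 1)
      (hcont _ fun s hs => Set.mem_Ioi.2 (zero_lt_one.trans_le hs)) (fun s hs => ?_) (fun s hs => ?_)
      (Set.mem_Ici.2 le_rfl) (Set.mem_Ici.2 h) h
    · rw [interior_Ici] at hs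
      exact (hder s (zero_lt_one.trans hs)).differentiableAt.differentiableWithinAt
    · rw [interior_Ici] at hs
      rw [(hder s (zero_lt_one.trans hs)).deriv]
      have : 0 ≤ s - 1 := sub_nonneg.2 (le_of_lt hs)
      positivity

/-- This is `log_ge_pade` at `t = y / z`, multiplied by `y`. The denominators are linear, hence have
a known sum over the simplex. -/
lemma relEntropy_summand_ge {y z : ℝ} (hy : 0 ≤ y) (hz : 0 < z) :
    3 / 2 * ((y - z) ^ 2 / (y + 2 * z)) ≤ y * (Real.log y - Real.log z) - y + z := by
  obtain rfl | hy := hy.eq_or_lt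
  · simp only [zero_sub, zero_add, zero_mul, neg_sq, sub_zero]
    rw [show 3 / 2 * (z ^ 2 / (2 * z)) = 3 / 4 * z by field_simp; ring]
    linarith
  · have h := mul_le_mul_of_nonneg_left (log_ge_pade (div_pos hy hz)) hy.le
    rw [Real.log_div hy.ne' hz.ne'] at h
    have e : y * ((y / z - 1) * (5 * (y / z) + 1) / (2 * (y / z) * (y / z + 2))) - y + z =
        3 / 2 * ((y - z) ^ 2 / (y + 2 * z)) := by
      have : y + 2 * z ≠ 0 := by positivity
      have : y / z + 2 ≠ 0 := by positivity
      have : y + z * 2 ≠ 0 := by positivity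
      field_simp
      ring
    linarith

/-- Pinsker's inequality on the simplex. -/
lemma pinsker {y z : Fin m → ℝ} (hy : y ∈ stdSimplex ℝ (Fin m)) (hz : ∀ i, 0 < z i)
    (hz1 : ∑ i, z i = 1) : (∑ i, |y i - z i|) ^ 2 / 2 ≤ relEntropy y z := by
  have hpos : ∀ i, 0 < y i + 2 * z i := fun i => by have := hy.1 i; have := hz i; positivity
  -- Cauchy-Schwarz with weights of total mass `3`; the factor `3 / 2` of the summands then becomes
  -- `1 / 2`.
  have h1 := Finset.sq_sum_div_le_sum_sq_div Finset.univ (fun i => |y i - z i|)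
    (g := fun i => y i + 2 * z i) (fun i _ => hpos i)
  have h2 : ∑ i, (y i + 2 * z i) = 3 := by
    rw [Finset.sum_add_distrib, ← Finset.mul_sum, hy.2, hz1]; norm_num
  have h3 : ∑ i, 3 / 2 * ((y i - z i) ^ 2 / (y i + 2 * z i)) ≤
      ∑ i, (y i * (Real.log (y i) - Real.log (z i)) - y i + z i) :=
    Finset.sum_le_sum fun i _ => relEntropy_summand_ge (hy.1 i) (hz i)
  rw [Finset.sum_add_distrib, Finset.sum_sub_distrib, hy.2, hz1, ← Finset.mul_sum] at h3
  simp only [sq_abs] at h1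
  rw [h2] at h1
  rw [relEntropy]
  linarith

lemma relEntropy_nonneg {y z : Fin m → ℝ} (hy : y ∈ stdSimplex ℝ (Fin m)) (hz : ∀ i, 0 < z i)
    (hz1 : ∑ i, z i = 1) : 0 ≤ relEntropy y z :=
  le_trans (by positivity) (pinsker hy hz hz1)

lemma relEntropy_self (y : Fin m → ℝ) : relEntropy y y = 0 := by simp [relEntropy]

lemma relEntropy_single_centre (i : Fin m) :
    relEntropy (Pi.single i 1) (simplexCentre m) = Real.log m := by
  rw [relEntropy, Finset.sum_eq_single i]
  · simp [simplexCentre]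
  · intro j _ hj
    simp [hj]
  · simp

/-! ### The Bregman projection -/

section Bregman

variable [Nonempty (Fin m)]

lemma bregman_denom_pos {z : Fin m → ℝ} (hz : ∀ i, 0 < z i) (s : Fin m → ℝ) :
    0 < ∑ j, z j * Real.exp (s j) :=
  Finset.sum_pos (fun j _ => mul_pos (hz j) (Real.exp_pos _)) Finset.univ_nonempty

lemma bregman_pos {z : Fin m → ℝ} (hz : ∀ i, 0 < z i) (s : Fin m → ℝ) (i : Fin m) :
    0 < bregman z s i :=
  div_pos (mul_pos (hz i) (Real.exp_pos _)) (bregman_denom_pos hz s)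

lemma sum_bregman {z : Fin m → ℝ} (hz : ∀ i, 0 < z i) (s : Fin m → ℝ) :
    ∑ i, bregman z s i = 1 := by
  simp only [bregman]
  rw [← Finset.sum_div, div_self (bregman_denom_pos hz s).ne']

lemma bregman_mem {z : Fin m → ℝ} (hz : ∀ i, 0 < z i) (s : Fin m → ℝ) :
    bregman z s ∈ stdSimplex ℝ (Fin m) :=
  ⟨fun i => (bregman_pos hz s i).le, sum_bregman hz s⟩

/-- The three-point identity of the Bregman projection. -/
lemma bregman_identity {z : Fin m → ℝ} (hz : ∀ i, 0 < z i) (s y : Fin m → ℝ)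
    (hy : ∑ i, y i = 1) :
    ∑ i, y i * s i - relEntropy y z =
      Real.log (∑ j, z j * Real.exp (s j)) - relEntropy y (bregman z s) := by
  have hlog : ∀ i, Real.log (bregman z s i) =
      Real.log (z i) + s i - Real.log (∑ j, z j * Real.exp (s j)) := fun i => by
    rw [bregman, Real.log_div (mul_pos (hz i) (Real.exp_pos _)).ne' (bregman_denom_pos hz s).ne',
      Real.log_mul (hz i).ne' (Real.exp_pos _).ne', Real.log_exp]
  rw [← mul_one (Real.log (∑ j, z j * Real.exp (s j))), ← hy, Finset.mul_sum, relEntropy,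
    relEntropy, ← Finset.sum_sub_distrib, ← Finset.sum_sub_distrib]
  refine Finset.sum_congr rfl fun i _ => ?_
  rw [hlog]
  ring

/-- The Bregman projection maximizes the linear functional penalized by the relative entropy. -/
lemma bregman_optimal {z : Fin m → ℝ} (hz : ∀ i, 0 < z i) (s : Fin m → ℝ) {y : Fin m → ℝ}
    (hy : y ∈ stdSimplex ℝ (Fin m)) :
    ∑ i, y i * s i - relEntropy y z ≤
      ∑ i, bregman z s i * s i - relEntropy (bregman z s) z := by
  rw [bregman_identity hz s y hy.2, bregman_identity hz s _ (sum_bregman hz s), relEntropy_self]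
  linarith [relEntropy_nonneg hy (bregman_pos hz s) (sum_bregman hz s)]

lemma natCast_pos_of_nonempty : 0 < (m : ℝ) := by
  have : 0 < m := Fin.pos_iff_nonempty.2 ‹_›
  exact_mod_cast this

lemma simplexCentre_pos (i : Fin m) : 0 < simplexCentre m i := one_div_pos.2 natCast_pos_of_nonempty

lemma sum_simplexCentre : ∑ i, simplexCentre m i = 1 := by
  have := (natCast_pos_of_nonempty (m := m)).ne'
  simp [simplexCentre, this]

lemma dualPt_pos (f : Fin m → E p → ℝ) (c : E p) (mu : ℝ) (x : E p) (i : Fin m) :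
    0 < dualPt f c mu x i := bregman_pos simplexCentre_pos _ i

lemma dualPt_mem (f : Fin m → E p → ℝ) (c : E p) (mu : ℝ) (x : E p) :
    dualPt f c mu x ∈ stdSimplex ℝ (Fin m) := bregman_mem simplexCentre_pos _

end Bregman

/-! ### The dual function -/

/-- Completing the square: for fixed `u` the saddle function is quadratic in `x` with Hessian `L`
times the identity. -/
lemma saddle_eq_sq {L : ℝ} (hL : 0 < L) (f : Fin m → E p → ℝ) (c x : E p) (u : Fin m → ℝ) :
    saddle f L c x u =
      saddle f L c (primalPt f L c u) u + L / 2 * ‖x - primalPt f L c u‖ ^ 2 := by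
  set S := ∑ i, u i • ∇ (f i) c with hS
  have h : ∀ w : E p, saddle f L c w u =
      ∑ i, u i * f i c + inner ℝ S (w - c) + L / 2 * ‖w - c‖ ^ 2 := fun w => by
    simp only [saddle, lin, mul_add, Finset.sum_add_distrib, hS, sum_inner, inner_smul_left,
      conj_trivial]
  have e1 : primalPt f L c u - c = -((1 / L) • S) := by simp [primalPt, hS]
  have e2 : x - primalPt f L c u = (x - c) + (1 / L) • S := by
    simp only [primalPt, hS]; abel
  rw [h x, h (primalPt f L c u), e1, e2, norm_add_sq_real, norm_neg, inner_neg_right,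
    inner_smul_right, inner_smul_right, norm_smul, mul_pow, real_inner_self_eq_norm_sq,
    real_inner_comm S (x - c), Real.norm_eq_abs, sq_abs]
  field_simp
  ring

lemma saddle_primalPt_le {L : ℝ} (hL : 0 < L) (f : Fin m → E p → ℝ) (c x : E p)
    (u : Fin m → ℝ) : saddle f L c (primalPt f L c u) u ≤ saddle f L c x u := by
  rw [saddle_eq_sq hL f c x u]
  have : 0 ≤ L / 2 * ‖x - primalPt f L c u‖ ^ 2 := by positivity
  linarith

lemma dualFun_eq {L : ℝ} (hL : 0 < L) (f : Fin m → E p → ℝ) (c : E p) (u : Fin m → ℝ) :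
    dualFun f L c u = saddle f L c (primalPt f L c u) u :=
  le_antisymm
    (ciInf_le ⟨_, Set.forall_mem_range.2 fun x => saddle_primalPt_le hL f c x u⟩ _)
    (le_ciInf fun x => saddle_primalPt_le hL f c x u)

lemma dualFun_le_saddle {L : ℝ} (hL : 0 < L) (f : Fin m → E p → ℝ) (c x : E p)
    (u : Fin m → ℝ) : dualFun f L c u ≤ saddle f L c x u := by
  rw [dualFun_eq hL]
  exact saddle_primalPt_le hL f c x u

/-- The dual function is smooth with respect to the `ℓ¹` norm, with constant `G ^ 2 / L`. -/
lemma saddle_primalPt_sub_le {L G : ℝ} (hL : 0 < L) {f : Fin m → E p → ℝ}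
    {c : E p} (hf : ∀ i, ‖∇ (f i) c‖ ≤ G) (u w : Fin m → ℝ) :
    saddle f L c (primalPt f L c w) u - G ^ 2 / L * ((∑ i, |u i - w i|) ^ 2 / 2) ≤
      dualFun f L c u := by
  rw [dualFun_eq hL, saddle_eq_sq hL f c (primalPt f L c w) u]
  -- The loss is exactly `L / 2` times the squared distance of the two primal points, which is at
  -- most `G / L` times the `ℓ¹` distance of `u` and `w`.
  have e : primalPt f L c w - primalPt f L c u = (1 / L) • ∑ i, (u i - w i) • ∇ (f i) c := by
    simp only [primalPt, sub_smul, Finset.sum_sub_distrib, smul_sub]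
    abel
  have hn : ‖∑ i, (u i - w i) • ∇ (f i) c‖ ≤ G * ∑ i, |u i - w i| := by
    rw [Finset.mul_sum]
    refine norm_sum_le_of_le _ fun i _ => ?_
    rw [norm_smul, Real.norm_eq_abs, mul_comm]
    exact mul_le_mul_of_nonneg_right (hf i) (abs_nonneg _)
  have hsq := pow_le_pow_left₀ (norm_nonneg _) hn 2
  rw [e, norm_smul, mul_pow, Real.norm_eq_abs, sq_abs]
  have : L / 2 * ((1 / L) ^ 2 * ‖∑ i, (u i - w i) • ∇ (f i) c‖ ^ 2) ≤
      L / 2 * ((1 / L) ^ 2 * (G * ∑ i, |u i - w i|) ^ 2) := by gcongr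
  have e2 : L / 2 * ((1 / L) ^ 2 * (G * ∑ i, |u i - w i|) ^ 2) =
      G ^ 2 / L * ((∑ i, |u i - w i|) ^ 2 / 2) := by field_simp
  linarith

lemma saddle_sub_saddle (f : Fin m → E p → ℝ) (L : ℝ) (c x : E p) (u w : Fin m → ℝ) :
    saddle f L c x u = saddle f L c x w + ∑ i, (u i - w i) * lin f c x i := by
  simp only [saddle, sub_mul, Finset.sum_sub_distrib]
  ring

lemma saddle_le_model (f : Fin m → E p → ℝ) (L : ℝ) (c x : E p) {u : Fin m → ℝ}
    (hu : u ∈ stdSimplex ℝ (Fin m)) : saddle f L c x u ≤ model f L c x := by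
  have h : ∀ i, lin f c x i + L / 2 * ‖x - c‖ ^ 2 ≤ model f L c x := fun i =>
    le_ciSup (f := fun i => lin f c x i + L / 2 * ‖x - c‖ ^ 2) (Set.finite_range _).bddAbove i
  calc saddle f L c x u = ∑ i, u i * (lin f c x i + L / 2 * ‖x - c‖ ^ 2) := by
        simp only [saddle, mul_add, Finset.sum_add_distrib, ← Finset.sum_mul, hu.2, one_mul]
    _ ≤ ∑ i, u i * model f L c x :=
        Finset.sum_le_sum fun i _ => mul_le_mul_of_nonneg_left (h i) (hu.1 i)
    _ = model f L c x := by rw [← Finset.sum_mul, hu.2, one_mul]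

/-- Convexity of the saddle function in the primal variable. -/
lemma saddle_convex_comb {L : ℝ} (hL : 0 < L) (f : Fin m → E p → ℝ) (c x x' : E p)
    (u : Fin m → ℝ) {τ : ℝ} (h0 : 0 ≤ τ) (h1 : τ ≤ 1) :
    saddle f L c ((1 - τ) • x + τ • x') u ≤
      (1 - τ) * saddle f L c x u + τ * saddle f L c x' u := by
  have hx := saddle_eq_sq hL f c x u
  have hx' := saddle_eq_sq hL f c x' u
  have hxx := saddle_eq_sq hL f c ((1 - τ) • x + τ • x') u
  set a := x - primalPt f L c u with ha
  set b := x' - primalPt f L c u with hb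
  have e : (1 - τ) • x + τ • x' - primalPt f L c u = (1 - τ) • a + τ • b := by
    rw [ha, hb]; module
  have hsq : ‖(1 - τ) • a + τ • b‖ ^ 2 ≤ (1 - τ) * ‖a‖ ^ 2 + τ * ‖b‖ ^ 2 := by
    have h2 : 0 ≤ τ * (1 - τ) * ‖a - b‖ ^ 2 :=
      mul_nonneg (mul_nonneg h0 (by linarith)) (sq_nonneg _)
    rw [norm_sub_sq_real] at h2
    rw [norm_add_sq_real, norm_smul, norm_smul, mul_pow, mul_pow, Real.norm_eq_abs,
      Real.norm_eq_abs, sq_abs, sq_abs, inner_smul_left, inner_smul_right, conj_trivial]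
    linarith
  have h3 : L / 2 * ‖(1 - τ) • a + τ • b‖ ^ 2 ≤ L / 2 * ((1 - τ) * ‖a‖ ^ 2 + τ * ‖b‖ ^ 2) := by
    gcongr
  rw [hxx, hx, hx', e]
  linarith

/-! ### The excessive gap condition -/

/-- The excessive gap condition for the smoothing parameter `mu` at the pair `s`. -/
def ExcessiveGap (f : Fin m → E p → ℝ) (L : ℝ) (c : E p) (mu : ℝ)
    (s : E p × (Fin m → ℝ)) : Prop :=
  s.2 ∈ stdSimplex ℝ (Fin m) ∧ ∀ y ∈ stdSimplex ℝ (Fin m),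
    saddle f L c s.1 y - mu * relEntropy y (simplexCentre m) ≤ dualFun f L c s.2

variable [Nonempty (Fin m)] {L G : ℝ} {f : Fin m → E p → ℝ} {c : E p}

/-- The exact deficit of `y` against the maximizer `dualPt` is `mu` times their relative entropy;
this slack pays for the next step of the method. -/
lemma dualPt_identity (f : Fin m → E p → ℝ) (c : E p) (L : ℝ) {mu : ℝ} (hmu : 0 < mu) (x : E p)
    {y : Fin m → ℝ} (hy : y ∈ stdSimplex ℝ (Fin m)) :
    saddle f L c x y - mu * relEntropy y (simplexCentre m) =
      saddle f L c x (dualPt f c mu x) - mu * relEntropy (dualPt f c mu x) (simplexCentre m)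
        - mu * relEntropy y (dualPt f c mu x) := by
  have hs : ∀ w : Fin m → ℝ, saddle f L c x w =
      mu * (∑ i, w i * (lin f c x i / mu)) + L / 2 * ‖x - c‖ ^ 2 := fun w => by
    rw [saddle, Finset.mul_sum]
    congr 1
    refine Finset.sum_congr rfl fun i _ => ?_
    field_simp
  have h1 := bregman_identity (simplexCentre_pos (m := m)) (fun i => lin f c x i / mu) y hy.2
  have h2 := bregman_identity (simplexCentre_pos (m := m)) (fun i => lin f c x i / mu) _
    (dualPt_mem f c mu x).2
  change _ = _ - relEntropy y (dualPt f c mu x) at h1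
  change _ = _ - relEntropy (dualPt f c mu x) (dualPt f c mu x) at h2
  rw [relEntropy_self] at h2
  rw [hs, hs]
  linear_combination mu * h1 - mu * h2

/-- The model is the maximum of the saddle function over the vertices of the simplex, whose relative
entropy to the centre is `log m`. -/
lemma ExcessiveGap.gap_le {mu : ℝ} {s : E p × (Fin m → ℝ)} (h : ExcessiveGap f L c mu s) :
    model f L c s.1 - dualFun f L c s.2 ≤ mu * Real.log m := by
  rw [sub_le_iff_le_add]
  refine ciSup_le fun i => ?_
  have h1 := h.2 (Pi.single i 1) (single_mem_stdSimplex ℝ i)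
  rw [relEntropy_single_centre] at h1
  have h2 : saddle f L c s.1 (Pi.single i 1) = lin f c s.1 i + L / 2 * ‖s.1 - c‖ ^ 2 := by
    simp [saddle, Pi.single_apply]
  linarith

/-- By `dualPt_identity` only the maximizer `v` has to be tested. There the smoothness of the dual
function around the centre costs at most what Pinsker's inequality recovers from the entropy. -/
lemma excessiveGap_start (hL : 0 < L) (hG : 0 < G) (hf : ∀ i, ‖∇ (f i) c‖ ≤ G) {mu : ℝ}
    (hmu : G ^ 2 / L ≤ mu) :
    ExcessiveGap f L c mu (primalPt f L c (simplexCentre m),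
      dualPt f c mu (primalPt f L c (simplexCentre m))) := by
  have hmu0 : 0 < mu := lt_of_lt_of_le (by positivity) hmu
  refine ⟨dualPt_mem _ _ _ _, fun y hy => ?_⟩
  set x := primalPt f L c (simplexCentre m) with hx
  have hv := dualPt_mem f c mu x
  set v := dualPt f c mu x with hvd
  change _ ≤ dualFun f L c v
  rw [dualPt_identity f c L hmu0 x hy, ← hvd]
  have h1 := relEntropy_nonneg hy (dualPt_pos f c mu x) hv.2
  have h2 := pinsker hv (simplexCentre_pos (m := m)) sum_simplexCentre
  have h3 := saddle_primalPt_sub_le hL hf v (simplexCentre m)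
  rw [← hx] at h3
  have h4 : G ^ 2 / L * ((∑ i, |v i - simplexCentre m i|) ^ 2 / 2) ≤
      mu * relEntropy v (simplexCentre m) := mul_le_mul hmu h2 (by positivity) hmu0.le
  have h5 := mul_nonneg hmu0.le h1
  linarith

/-- After convexity in `x`, the old condition leaves the slack `(1 - τ) * mu * relEntropy y z`
against a gain that is linear in `y - z`. The point `v` maximizes the gain minus the slack. Since
`u' - w = τ • (v - z)`, dual smoothness around `w` costs a term of order `τ ^ 2`, which `hτ` and
Pinsker's inequality cover. -/
lemma ExcessiveGap.step (hL : 0 < L) (hf : ∀ i, ‖∇ (f i) c‖ ≤ G) {mu τ : ℝ}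
    (hmu : 0 < mu) (h0 : 0 < τ) (h1 : τ < 1) (hτ : τ ^ 2 * (G ^ 2 / L) ≤ (1 - τ) * mu)
    {s : E p × (Fin m → ℝ)} (h : ExcessiveGap f L c mu s) :
    ExcessiveGap f L c ((1 - τ) * mu) (egStep f L c mu τ s) := by
  obtain ⟨x, u⟩ := s
  obtain ⟨hu, hgap⟩ := h
  set z : Fin m → ℝ := dualPt f c mu x with hz
  set w : Fin m → ℝ := (1 - τ) • u + τ • z with hw
  set x' : E p := primalPt f L c w with hx'
  set v : Fin m → ℝ := bregman z (fun i => τ / ((1 - τ) * mu) * lin f c x' i) with hv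
  set u' : Fin m → ℝ := (1 - τ) • u + τ • v with hu'
  have h1' : 0 < 1 - τ := by linarith
  have hzpos : ∀ i, 0 < z i := dualPt_pos f c mu x
  have hzmem : z ∈ stdSimplex ℝ (Fin m) := dualPt_mem f c mu x
  have hvmem : v ∈ stdSimplex ℝ (Fin m) := bregman_mem hzpos _
  have humem : u' ∈ stdSimplex ℝ (Fin m) :=
    convex_stdSimplex ℝ (Fin m) hu hvmem h1'.le h0.le (by ring)
  change u' ∈ _ ∧ ∀ y ∈ _, saddle f L c ((1 - τ) • x + τ • x') y - _ ≤ dualFun f L c u'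
  refine ⟨humem, fun y hy => ?_⟩
  have hc := saddle_convex_comb hL f c x x' y h0.le h1.le
  -- the old excessive gap condition, with the slack at `y`
  have hold := hgap z hzmem
  have hid := dualPt_identity f c L hmu x hy
  rw [← hz] at hid
  change _ ≤ dualFun f L c u at hold
  have hdual := dualFun_le_saddle hL f c x' u
  have hlu := saddle_sub_saddle f L c x' u w
  have hly := saddle_sub_saddle f L c x' y w
  have hcomb : (1 - τ) * ∑ i, (u i - w i) * lin f c x' i + τ * ∑ i, (y i - w i) * lin f c x' i =
      τ * (∑ i, y i * lin f c x' i - ∑ i, z i * lin f c x' i) := by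
    rw [← Finset.sum_sub_distrib, Finset.mul_sum, Finset.mul_sum, Finset.mul_sum,
      ← Finset.sum_add_distrib]
    refine Finset.sum_congr rfl fun i _ => ?_
    simp only [hw, Pi.add_apply, Pi.smul_apply, smul_eq_mul]
    ring
  -- optimality of `v`
  have hopt := bregman_optimal hzpos (fun i => τ / ((1 - τ) * mu) * lin f c x' i) hy
  rw [← hv] at hopt
  have hscale : ∀ a : Fin m → ℝ, (1 - τ) * mu * ∑ i, a i * (τ / ((1 - τ) * mu) * lin f c x' i) =
      τ * ∑ i, a i * lin f c x' i := fun a => by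
    rw [Finset.mul_sum, Finset.mul_sum]
    refine Finset.sum_congr rfl fun i _ => ?_
    field_simp
  have hopt' := mul_le_mul_of_nonneg_left hopt (mul_pos h1' hmu).le
  rw [mul_sub, mul_sub, hscale, hscale] at hopt'
  -- smoothness of the dual function
  have hsm := saddle_primalPt_sub_le hL hf u' w
  rw [← hx', saddle_sub_saddle f L c x' u' w] at hsm
  have hdiff : ∀ i, u' i - w i = τ * (v i - z i) := fun i => by
    simp only [hu', hw, Pi.add_apply, Pi.smul_apply, smul_eq_mul]
    ring
  have hsum : ∑ i, (u' i - w i) * lin f c x' i =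
      τ * (∑ i, v i * lin f c x' i - ∑ i, z i * lin f c x' i) := by
    rw [← Finset.sum_sub_distrib, Finset.mul_sum]
    refine Finset.sum_congr rfl fun i _ => ?_
    rw [hdiff]; ring
  have habs : ∑ i, |u' i - w i| = τ * ∑ i, |v i - z i| := by
    rw [Finset.mul_sum]
    refine Finset.sum_congr rfl fun i _ => ?_
    rw [hdiff, abs_mul, abs_of_pos h0]
  rw [hsum, habs] at hsm
  have hpin := pinsker hvmem hzpos hzmem.2
  have hquad : τ ^ 2 * (G ^ 2 / L) * ((∑ i, |v i - z i|) ^ 2 / 2) ≤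
      (1 - τ) * mu * relEntropy v z :=
    mul_le_mul hτ hpin (by positivity) (mul_pos h1' hmu).le
  have hA := mul_le_mul_of_nonneg_left (hdual.trans_eq hlu) h1'.le
  have hB := mul_le_mul_of_nonneg_left hold h1'.le
  rw [hly] at hc
  linear_combination hc + hA + hB + hcomb + hopt' + hsm + hquad + (1 - τ) * hid

/-! ### Convergence of the inner solver -/

lemma smoothing_pos (hL : 0 < L) (hG : 0 < G) (k : ℕ) : 0 < smoothing L G k := by
  unfold smoothing; positivity

lemma smoothing_succ (L G : ℝ) (k : ℕ) :
    smoothing L G (k + 1) = (1 - 2 / ((k : ℝ) + 3)) * smoothing L G k := by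
  simp only [smoothing]
  push_cast
  have h1 : (k : ℝ) + 1 ≠ 0 := by positivity
  have h2 : (k : ℝ) + 2 ≠ 0 := by positivity
  have h3 : (k : ℝ) + 3 ≠ 0 := by positivity
  have h4 : (k : ℝ) + 1 + 1 ≠ 0 := by positivity
  have h5 : (k : ℝ) + 1 + 2 ≠ 0 := by positivity
  rw [div_eq_iff (mul_ne_zero h4 h5)]
  field_simp
  ring

lemma excessiveGap_egIter (hL : 0 < L) (hG : 0 < G) (hf : ∀ i, ‖∇ (f i) c‖ ≤ G) (k : ℕ) :
    ExcessiveGap f L c (smoothing L G k) (egIter f L G c k) := by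
  induction k with
  | zero =>
    refine excessiveGap_start hL hG hf ?_
    have : 0 < G ^ 2 / L := by positivity
    simp only [smoothing]
    norm_num
    linarith
  | succ k ih =>
    rw [smoothing_succ]
    have hk : (0 : ℝ) ≤ k := k.cast_nonneg
    refine ih.step hL hf (smoothing_pos hL hG k) (by positivity) ?_ ?_
    · rw [div_lt_one (by positivity)]; linarith
    · rw [← smoothing_succ, smoothing]
      push_cast
      have hQ : 0 < G ^ 2 / L := by positivity
      rw [le_div_iff₀ (by positivity)]
      -- The left side equals `4 * (k + 2) / (k + 3)`.
      have : (2 / ((k : ℝ) + 3)) ^ 2 * (((k : ℝ) + 1 + 1) * ((k : ℝ) + 1 + 2)) ≤ 4 := by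
        rw [div_pow, div_mul_eq_mul_div, div_le_iff₀ (by positivity)]
        nlinarith
      nlinarith

lemma egGap_le (hL : 0 < L) (hG : 0 < G) (hf : ∀ i, ‖∇ (f i) c‖ ≤ G) (k : ℕ) :
    egGap f L G c k ≤ smoothing L G k * Real.log m :=
  (excessiveGap_egIter hL hG hf k).gap_le

/-- The target is `ε ^ 2 / (256 * L)`, so `(k + 1) * (k + 2) ≥ 2 ^ 10 * G ^ 2 * log m / ε ^ 2`
suffices. Having `k + 1` in the hypothesis spares a rounding term in the iteration count. -/
lemma egGap_le_of_le (hL : 0 < L) (hG : 0 < G) (hf : ∀ i, ‖∇ (f i) c‖ ≤ G) {ε : ℝ}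
    (hε : 0 < ε) {k : ℕ} (hk : 2 ^ 5 * G / ε * √(Real.log m) ≤ (k : ℝ) + 1) :
    egGap f L G c k ≤ innerTol L ε / 4 := by
  refine (egGap_le hL hG hf k).trans ?_
  have hlog : 0 ≤ Real.log m := Real.log_natCast_nonneg m
  have h1 := pow_le_pow_left₀ (by positivity) hk 2
  rw [mul_pow, Real.sq_sqrt hlog, div_pow, div_mul_eq_mul_div, div_le_iff₀ (by positivity)] at h1
  have h2 : 2 ^ 10 * G ^ 2 * Real.log m ≤ ((k : ℝ) + 1) * ((k : ℝ) + 2) * ε ^ 2 := by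
    have hk0 : (0 : ℝ) ≤ k := k.cast_nonneg
    have : 0 ≤ ((k : ℝ) + 1) * ε ^ 2 := by positivity
    nlinarith
  rw [smoothing, innerTol, div_mul_eq_mul_div, div_le_iff₀ (by positivity)]
  have e1 : 4 * (G ^ 2 / L) * Real.log m = 2 ^ 10 * G ^ 2 * Real.log m / (256 * L) := by
    field_simp; ring
  have e2 : ε ^ 2 / (64 * L) / 4 * (((k : ℝ) + 1) * ((k : ℝ) + 2)) =
      ((k : ℝ) + 1) * ((k : ℝ) + 2) * ε ^ 2 / (256 * L) := by field_simp; norm_num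
  rw [e1, e2]
  gcongr

/-- The iteration count of the inner solver. -/
lemma InnerSolve.iters_le (hL : 0 < L) (hG : 0 < G) (hf : ∀ i, ‖∇ (f i) c‖ ≤ G) {ε : ℝ}
    (hε : 0 < ε) {N : ℕ} {x : E p} (h : InnerSolve f L G (innerTol L ε / 4) c N x) :
    (N : ℝ) ≤ 2 ^ 5 * G / ε * √(Real.log m) := by
  by_contra! hN
  have hB : 0 ≤ 2 ^ 5 * G / ε * √(Real.log m) := by positivity
  -- If `N` exceeded the bound, the gap would already be small enough after `N - 1` iterations.
  obtain ⟨n, rfl⟩ : ∃ n, N = n + 1 :=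
    Nat.exists_eq_succ_of_ne_zero fun h0 => by simp [h0] at hN; linarith
  exact (h.2.1 n n.lt_succ_self).not_ge
    (egGap_le_of_le hL hG hf hε (by push_cast at hN; exact hN.le))

lemma exists_innerSolve (hL : 0 < L) (hG : 0 < G) (hf : ∀ i, ‖∇ (f i) c‖ ≤ G) {ε : ℝ}
    (hε : 0 < ε) : ∃ N x, InnerSolve f L G (innerTol L ε / 4) c N x := by
  classical
  have hex : ∃ N, egGap f L G c N ≤ innerTol L ε / 4 := by
    obtain ⟨k, hk⟩ := exists_nat_ge (2 ^ 5 * G / ε * √(Real.log m))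
    exact ⟨k, egGap_le_of_le hL hG hf hε (by linarith)⟩
  exact ⟨Nat.find hex, _, Nat.find_spec hex, fun n hn => not_le.1 (Nat.find_min hex hn), rfl⟩

/-- The output of the inner solver is a minimizer of the model up to the tolerance. -/
lemma InnerSolve.model_le (hL : 0 < L) (hG : 0 < G) (hf : ∀ i, ‖∇ (f i) c‖ ≤ G) {δ : ℝ}
    {N : ℕ} {x : E p} (h : InnerSolve f L G δ c N x) (y : E p) :
    model f L c x ≤ model f L c y + δ := by
  obtain ⟨hgap, -, rfl⟩ := h
  have h1 := (dualFun_le_saddle hL f c y _).trans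
    (saddle_le_model f L c y (excessiveGap_egIter hL hG hf N).1)
  rw [egGap] at hgap
  linarith

end

section

variable {p m : ℕ} [Nonempty (Fin m)] {f : Fin m → E p → ℝ} {G L ε fstar : ℝ}

/-! ### The model and the stopping test -/

lemma maxFun_le_model (hf : ∀ i, LSmooth L (f i)) (c x : E p) :
    maxFun f x ≤ model f L c x := by
  refine ciSup_le fun i => ?_
  have h1 := (abs_le.1 ((hf i).abs_sub_le c x)).2
  refine le_trans ?_ (le_ciSup (f := fun i => lin f c x i + L / 2 * ‖x - c‖ ^ 2)
    (Set.finite_range _).bddAbove i)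
  simp only [lin]
  linarith

lemma model_le_maxFun_add (hf : ∀ i, LSmooth L (f i)) (c x : E p) :
    model f L c x ≤ maxFun f x + L * ‖c - x‖ ^ 2 := by
  refine ciSup_le fun i => ?_
  have h1 := (abs_le.1 ((hf i).abs_sub_le c x)).1
  have h2 := le_maxFun f x i
  rw [norm_sub_rev c x]
  simp only [lin]
  linarith

/-- The stopping test of Prox-FDIAG certifies approximate stationarity. -/
lemma isFOSP_of_test (hL : 0 < L) (hε : 0 < ε) (hf : ∀ i, LSmooth L (f i))
    (hbdd : ∀ x, fstar ≤ maxFun f x) {x : E p}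
    (htest : ∀ y, maxFun f x - innerTol L ε ≤ model f L x y) :
    IsFOSP L (maxFun f) ε x := by
  refine ⟨maxFun_weaklyConvex hf, ?_⟩
  obtain ⟨y, hy⟩ := exists_prox hL (maxFun_continuous hf) hbdd x
  have hgrow := prox_growth (fun a b t h0 h1 => maxFun_segment_le hf a b h0 h1) hy
  refine ⟨_, hasGradientAt_moreauEnv hL hgrow, ?_⟩
  have h1 := hgrow x
  have h2 := (htest y).trans (model_le_maxFun_add hf x y)
  rw [sub_self, norm_zero, innerTol] at *
  -- The model error `L * ‖x - y‖ ^ 2` cancels against the proximal term, leaving only the growth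
  -- term. The squared gradient norm is then at most `ε ^ 2 / 8`.
  have h3 : L / 2 * ‖x - y‖ ^ 2 ≤ ε ^ 2 / (64 * L) := by linarith
  rw [le_div_iff₀ (by positivity)] at h3
  rw [norm_smul, Real.norm_of_nonneg (by positivity)]
  refine le_of_sq_le_sq ?_ hε.le
  nlinarith [sq_nonneg (L * ‖x - y‖)]

/-! ### Cost of the two algorithms -/

lemma innerTol_pos (hL : 0 < L) (hε : 0 < ε) : 0 < innerTol L ε := by
  unfold innerTol; positivity

lemma innerTol_mono (hL : 0 < L) {ε' : ℝ} (hε : 0 < ε) (h : ε ≤ ε') :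
    innerTol L ε ≤ innerTol L ε' := by
  unfold innerTol; gcongr

/-- A run of Prox-FDIAG with `n` descent steps. -/
lemma ProxRun.cost (hG : 0 < G) (hL : 0 < L) (hε : 0 < ε) (hLip : ∀ i, GLipschitz G (f i))
    (hf : ∀ i, LSmooth L (f i)) (hbdd : ∀ x, fstar ≤ maxFun f x) {x out : E p}
    {calls iters : ℕ} (h : ProxRun f L G ε x out calls iters) :
    IsFOSP L (maxFun f) ε out ∧ ∃ n : ℕ, calls = (n + 1) * m ∧
      maxFun f out + n * (3 * innerTol L ε / 4) ≤ maxFun f x ∧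
      (iters : ℝ) ≤ ((n : ℝ) + 1) * (2 ^ 5 * G / ε * √(Real.log m)) := by
  have hgrad : ∀ (c : E p) (i : Fin m), ‖∇ (f i) c‖ ≤ G := fun c i =>
    (hLip i).norm_gradient_le hG.le c
  induction h with
  | halt x x' N hin htest =>
    refine ⟨isFOSP_of_test hL hε hf hbdd fun y => ?_, 0, by simp, by simp, ?_⟩
    -- The tested `3/4` and the solver error of `1/4` add up to the full tolerance.
    · have := hin.model_le hL hG (hgrad x) y
      linarith
    · simpa using hin.iters_le hL hG (hgrad x) hε
  | descend x x' out N calls iters hin htest _ ih =>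
    obtain ⟨hout, n, hcalls, hdesc, hit⟩ := ih
    refine ⟨hout, n + 1, by rw [hcalls]; ring, ?_, ?_⟩
    · have := maxFun_le_model hf x x'
      push_cast
      linarith
    · have := hin.iters_le hL hG (hgrad x) hε
      push_cast
      linarith

/-- Induction on a bound for the number of descent steps that `f x - fstar` can still afford; with
none left, the test must pass. -/
lemma exists_proxRun (hG : 0 < G) (hL : 0 < L) (hε : 0 < ε) (hLip : ∀ i, GLipschitz G (f i))
    (hf : ∀ i, LSmooth L (f i)) (hbdd : ∀ x, fstar ≤ maxFun f x) (x : E p) :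
    ∃ out calls iters, ProxRun f L G ε x out calls iters := by
  have htol := innerTol_pos hL hε
  obtain ⟨n, hn⟩ := exists_nat_ge ((maxFun f x - fstar) / (3 * innerTol L ε / 4))
  rw [div_le_iff₀ (by positivity)] at hn
  induction n generalizing x with
  | zero =>
    obtain ⟨N, x', hin⟩ := exists_innerSolve hL hG
      (fun i => (hLip i).norm_gradient_le hG.le x) hε
    refine ⟨_, _, _, .halt x x' N hin ?_⟩
    have h1 := maxFun_le_model hf x x'
    have h2 := hbdd x'
    push_cast at hn
    linarith
  | succ n ih =>
    obtain ⟨N, x', hin⟩ := exists_innerSolve hL hG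
      (fun i => (hLip i).norm_gradient_le hG.le x) hε
    by_cases htest : maxFun f x - 3 * innerTol L ε / 4 < model f L x x'
    · exact ⟨_, _, _, .halt x x' N hin htest⟩
    · have h1 := maxFun_le_model hf x x'
      push_cast at hn
      obtain ⟨out, calls, iters, hrest⟩ := ih x' (by linarith)
      exact ⟨_, _, _, .descend x x' out N calls iters hin htest hrest⟩

/-- A true halving lowers the logarithm by one. A truncated one starts from a logarithm in `(0, 1]`,
with ceiling `1`, and ends at `0`. -/
lemma ceil_logb_halve {ε' : ℝ} (hε : 0 < ε) (h : ε < ε') :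
    ⌈Real.logb 2 (ε' / ε)⌉₊ = ⌈Real.logb 2 (max (ε' / 2) ε / ε)⌉₊ + 1 := by
  have hε' := hε.trans h
  have e : Real.logb 2 (ε' / ε) = Real.logb 2 (ε' / 2 / ε) + 1 := by
    rw [show ε' / ε = ε' / 2 / ε * 2 by ring, Real.logb_mul (by positivity) two_ne_zero,
      Real.logb_self_eq_one one_lt_two]
  have hpos : 0 < Real.logb 2 (ε' / ε) := Real.logb_pos one_lt_two ((one_lt_div hε).2 h)
  obtain hc | hc := le_total ε (ε' / 2)
  · rw [max_eq_left hc, e, Nat.ceil_add_one]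
    exact Real.logb_nonneg one_lt_two ((one_le_div hε).2 hc)
  · rw [max_eq_right hc, div_self hε.ne', Real.logb_one, Nat.ceil_zero, zero_add,
      Nat.ceil_eq_iff one_ne_zero]
    refine ⟨by simpa using hpos, ?_⟩
    rw [e]
    have : Real.logb 2 (ε' / 2 / ε) ≤ 0 :=
      Real.logb_nonpos one_lt_two (by positivity) ((div_le_one hε).2 hc)
    push_cast
    linarith

/-- The loop of Adaptive Prox-FDIAG with `n` descent steps in all. -/
lemma AdaptiveLoop.cost (hG : 0 < G) (hL : 0 < L) (hε : 0 < ε)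
    (hLip : ∀ i, GLipschitz G (f i)) (hf : ∀ i, LSmooth L (f i))
    (hbdd : ∀ x, fstar ≤ maxFun f x) {ε' : ℝ} {x out : E p} {runs calls iters : ℕ}
    (h : AdaptiveLoop f L G ε ε' x out runs calls iters) (hle : ε ≤ ε') :
    runs = ⌈Real.logb 2 (ε' / ε)⌉₊ + 1 ∧ IsFOSP L (maxFun f) ε out ∧
      ∃ n : ℕ, calls = (n + runs) * m ∧
        maxFun f out + n * (3 * innerTol L ε / 4) ≤ maxFun f x ∧
        (iters : ℝ) ≤ ((n : ℝ) + runs) * (2 ^ 5 * G / ε * √(Real.log m)) := by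
  induction h with
  | last ε' x out calls iters hrun heq =>
    subst heq
    obtain ⟨hout, n, hcalls, hdesc, hit⟩ := hrun.cost hG hL hε hLip hf hbdd
    refine ⟨by simp [div_self hε.ne'], hout, n, hcalls, hdesc, by push_cast; exact hit⟩
  | next ε' x x' out runs calls iters calls' iters' hrun hne _ ih =>
    have hlt : ε < ε' := lt_of_le_of_ne hle hne
    obtain ⟨hruns, hout, n, hcalls, hdesc, hit⟩ := ih (le_max_right _ _)
    obtain ⟨-, n', hcalls', hdesc', hit'⟩ := hrun.cost hG hL (hε.trans hlt) hLip hf hbdd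
    refine ⟨by rw [ceil_logb_halve hε hlt, hruns]; ring, hout, n' + n, ?_, ?_, ?_⟩
    · rw [hcalls, hcalls']; ring
    -- Descent at a coarser accuracy gains at least as much, so all runs share one budget.
    · have : (n' : ℝ) * (3 * innerTol L ε / 4) ≤ n' * (3 * innerTol L ε' / 4) := by
        have := innerTol_mono hL hε hle
        gcongr
      push_cast
      linarith
    · have : ((n' : ℝ) + 1) * (2 ^ 5 * G / ε' * √(Real.log m)) ≤
          ((n' : ℝ) + 1) * (2 ^ 5 * G / ε * √(Real.log m)) := by gcongr
      push_cast
      linarith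

lemma exists_adaptiveLoop (hG : 0 < G) (hL : 0 < L) (hε : 0 < ε)
    (hLip : ∀ i, GLipschitz G (f i)) (hf : ∀ i, LSmooth L (f i))
    (hbdd : ∀ x, fstar ≤ maxFun f x) {ε' : ℝ} (hle : ε ≤ ε') (x : E p) :
    ∃ out runs calls iters, AdaptiveLoop f L G ε ε' x out runs calls iters := by
  induction hk : ⌈Real.logb 2 (ε' / ε)⌉₊ generalizing ε' x with
  | zero =>
    obtain ⟨out, calls, iters, hrun⟩ := exists_proxRun hG hL (hε.trans_le hle) hLip hf hbdd x
    obtain heq | hlt := hle.eq_or_lt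
    · exact ⟨_, _, _, _, .last ε' x out calls iters hrun heq⟩
    · rw [ceil_logb_halve hε hlt] at hk
      exact absurd hk (Nat.succ_ne_zero _)
  | succ k ih =>
    obtain ⟨x', calls, iters, hrun⟩ := exists_proxRun hG hL (hε.trans_le hle) hLip hf hbdd x
    obtain heq | hlt := hle.eq_or_lt
    · exact ⟨_, _, _, _, .last ε' x x' calls iters hrun heq⟩
    · rw [ceil_logb_halve hε hlt, Nat.add_right_cancel_iff] at hk
      obtain ⟨out, runs, calls', iters', hrest⟩ := ih (le_max_right _ _) x' hk
      exact ⟨_, _, _, _, .next ε' x x' out runs calls iters calls' iters' hrun hlt.ne hrest⟩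

lemma rpow_three_halves {a : ℝ} (ha : 0 ≤ a) : a ^ (3 / 2 : ℝ) = √a * a := by
  rw [Real.sqrt_eq_rpow, ← Real.rpow_add_one' ha (by norm_num)]
  norm_num

/-- Since `log m ≥ 1 / 2`, its power `3 / 2` is at least `1 / 4`, against a prefactor of at least
`16`. The factor `4` absorbs the two roundings in the second oracle bound. -/
lemma four_mul_le_ceil {m : ℕ} (hm : 2 ≤ m) (hε : 0 < ε) (hεG : ε ≤ G) :
    4 * m ≤ ⌈2 ^ 4 * G / ε * ((m : ℝ) * Real.log m ^ (3 / 2 : ℝ))⌉₊ := by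
  have hm' : (2 : ℝ) ≤ m := by exact_mod_cast hm
  have hlog : 1 / 2 ≤ Real.log m :=
    le_trans (by linarith [Real.log_two_gt_d9]) (Real.log_le_log two_pos hm')
  have hsq : 1 / 2 ≤ √(Real.log m) := Real.le_sqrt_of_sq_le (by linarith)
  have h1 : (1 / 4 : ℝ) ≤ Real.log m ^ (3 / 2 : ℝ) := by
    rw [rpow_three_halves (by linarith)]
    nlinarith
  have h2 : (16 : ℝ) ≤ 2 ^ 4 * G / ε := by
    rw [le_div_iff₀ hε]; linarith
  have h3 : (4 * m : ℝ) ≤ 2 ^ 4 * G / ε * ((m : ℝ) * Real.log m ^ (3 / 2 : ℝ)) := by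
    calc (4 * m : ℝ) = 16 * (m * (1 / 4)) := by ring
      _ ≤ _ := by gcongr
  exact_mod_cast h3.trans (Nat.le_ceil _)

end

end ProxFDIAG

end

theorem corollary2 {p m : ℕ} (hm : 0 < m) (f : Fin m → ProxFDIAG.E p → ℝ)
    (G L ε ε₀ fstar : ℝ) (hG : 0 < G) (hL : 0 < L) (hε : 0 < ε) (hε₀ : ε ≤ ε₀)
    (hLip : ∀ i, ProxFDIAG.GLipschitz G (f i)) (hsmooth : ∀ i, ProxFDIAG.LSmooth L (f i))
    (hbdd : ∀ x, fstar ≤ ProxFDIAG.maxFun f x) (x₀ : ProxFDIAG.E p) :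
    -- the algorithm halts
    (∃ (out : ProxFDIAG.E p) (runs calls iters : ℕ),
      ProxFDIAG.AdaptiveProxFDIAG f L G ε ε₀ x₀ out runs calls iters) ∧
    ∀ (out : ProxFDIAG.E p) (runs calls iters : ℕ),
      ProxFDIAG.AdaptiveProxFDIAG f L G ε ε₀ x₀ out runs calls iters →
      -- number of outer runs: the first one, and one after each halving
      runs = ⌈Real.logb 2 (ε₀ / ε)⌉₊ + 1 ∧
      -- quality of the output
      ProxFDIAG.IsFOSP L (ProxFDIAG.maxFun f) ε out ∧
      -- total work, where an iteration of the inner solver is charged `m log m`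
      (iters : ℝ) * ((m : ℝ) * Real.log m) ≤
        (((⌈Real.logb 2 (ε₀ / ε)⌉₊ + 1) *
          (⌊4 ^ 4 * L * (ProxFDIAG.maxFun f x₀ - fstar) / (3 * ε ^ 2)⌋₊ + 1) *
          ⌈2 ^ 5 * G / ε * ((m : ℝ) * Real.log m ^ (3 / 2 : ℝ))⌉₊ : ℕ) : ℝ) ∧
      -- total number of calls of the first-order oracle of the components
      calls ≤ (⌈Real.logb 2 (ε₀ / ε)⌉₊ + 1) *
        (⌊4 ^ 4 * L * (ProxFDIAG.maxFun f x₀ - fstar) / (3 * ε ^ 2)⌋₊ + 1) * m ∧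
      (ε < ε₀ → fstar < ProxFDIAG.maxFun f x₀ → 2 ≤ m → ε ≤ G →
        calls ≤ ⌈Real.logb 2 (ε₀ / ε)⌉₊ *
          ⌈4 ^ 4 * L * (ProxFDIAG.maxFun f x₀ - fstar) / (3 * ε ^ 2)⌉₊ *
          ⌈2 ^ 4 * G / ε * ((m : ℝ) * Real.log m ^ (3 / 2 : ℝ))⌉₊) := by
  have : Nonempty (Fin m) := Fin.pos_iff_nonempty.1 hm
  unfold ProxFDIAG.AdaptiveProxFDIAG
  rw [max_eq_left hε₀]
  refine ⟨ProxFDIAG.exists_adaptiveLoop hG hL hε hLip hsmooth hbdd hε₀ x₀,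
    fun out runs calls iters h => ?_⟩
  obtain ⟨hruns, hout, n, hcalls, hdesc, hit⟩ := h.cost hG hL hε hLip hsmooth hbdd hε₀
  refine ⟨hruns, hout, ?_⟩
  set K := ⌈Real.logb 2 (ε₀ / ε)⌉₊ with hK
  set C := 4 ^ 4 * L * (ProxFDIAG.maxFun f x₀ - fstar) / (3 * ε ^ 2) with hC
  -- `C` is the initial gap divided by the guaranteed decrease `3 * innerTol L ε / 4 = 3 * ε ^ 2 /
  -- (4 ^ 4 * L)`.
  have hnC : n ≤ ⌊C⌋₊ := by
    refine Nat.le_floor ?_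
    rw [hC, le_div_iff₀ (by positivity)]
    have h1 : (n : ℝ) * (3 * ProxFDIAG.innerTol L ε / 4) ≤ ProxFDIAG.maxFun f x₀ - fstar := by
      linarith [hbdd out]
    have h2 := mul_le_mul_of_nonneg_left h1 (show 0 ≤ 4 ^ 4 * L by positivity)
    refine le_trans (le_of_eq ?_) h2
    rw [ProxFDIAG.innerTol]
    field_simp
    ring
  have hcount : n + runs ≤ (K + 1) * (⌊C⌋₊ + 1) := by
    rw [hruns]; nlinarith [Nat.zero_le (K * ⌊C⌋₊)]
  refine ⟨?_, ?_, fun hlt hf hm2 hεG => ?_⟩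
  · have hlog : 0 ≤ Real.log m := Real.log_natCast_nonneg m
    have hX := Nat.le_ceil (2 ^ 5 * G / ε * ((m : ℝ) * Real.log m ^ (3 / 2 : ℝ)))
    set X := ⌈2 ^ 5 * G / ε * ((m : ℝ) * Real.log m ^ (3 / 2 : ℝ))⌉₊
    have hcount' : (n : ℝ) + runs ≤ (((K + 1) * (⌊C⌋₊ + 1) : ℕ) : ℝ) := by exact_mod_cast hcount
    calc (iters : ℝ) * ((m : ℝ) * Real.log m)
        ≤ ((n : ℝ) + runs) * (2 ^ 5 * G / ε * √(Real.log m)) * ((m : ℝ) * Real.log m) := by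
          gcongr
      _ = ((n : ℝ) + runs) * (2 ^ 5 * G / ε * ((m : ℝ) * Real.log m ^ (3 / 2 : ℝ))) := by
          rw [ProxFDIAG.rpow_three_halves hlog]; ring
      _ ≤ (((K + 1) * (⌊C⌋₊ + 1) : ℕ) : ℝ) * X := by gcongr
      _ = _ := by push_cast; ring
  · rw [hcalls]
    exact Nat.mul_le_mul_right m hcount
  · have hK1 : 1 ≤ K := Nat.one_le_ceil_iff.2
      (Real.logb_pos one_lt_two ((one_lt_div hε).2 hlt))
    have hCpos : 0 < C := by
      have : 0 < ProxFDIAG.maxFun f x₀ - fstar := sub_pos.2 hf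
      positivity
    have hC1 : 1 ≤ ⌈C⌉₊ := Nat.one_le_ceil_iff.2 hCpos
    have hfc : ⌊C⌋₊ ≤ ⌈C⌉₊ := Nat.floor_le_ceil C
    -- As `K` and `⌈C⌉₊` are at least `1`, each of the two added ones at most doubles its factor.
    have h4 : (K + 1) * (⌊C⌋₊ + 1) ≤ K * ⌈C⌉₊ * 4 :=
      calc (K + 1) * (⌊C⌋₊ + 1) ≤ (2 * K) * (2 * ⌈C⌉₊) := by gcongr <;> omega
        _ = K * ⌈C⌉₊ * 4 := by ring
    calc calls = (n + runs) * m := hcalls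
      _ ≤ K * ⌈C⌉₊ * 4 * m := Nat.mul_le_mul_right m (hcount.trans h4)
      _ = K * ⌈C⌉₊ * (4 * m) := by ring
      _ ≤ _ := Nat.mul_le_mul_left _ (ProxFDIAG.four_mul_le_ceil hm2 hε hεG)
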